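/- **Setting.** Let $n,N\ge 1$, let $\mathbf A\in\mathbb R^{n\times n}$ have ones on the superdiagonal and zeros elsewhere, $B=(0,\dots,0,1)^\top$, $C=(1,0,\dots,0)$, $\mathbf D_c=\operatorname{diag}\{n,n-1,\dots,1\}$ and $\mathbf\Lambda_r=\operatorname{diag}\{r^n,r^{n-1},\dots,r\}$. Let $\mathcal G$ be a connected undirected graph on the followers $1,\dots,N$ with adjacency matrix $(a_{k,j})$ and Laplacian $\mathcal L_{\mathcal G}$, let $\mathsf b_k\in\{0,1\}$ be $1$ exactly when follower $k$ is a neighbour of the leader (at least one is), and $\mathcal L_{\bar{\mathcal G}}=\mathcal L_{\mathcal G}+\operatorname{diag}\{\mathsf b_1,\dots,\mathsf b_N\}$. Let the row vectors $K,G\in\mathbb R^{1\times n}$ be such that $$\mathbf A_c=\mathbf I_N\otimes\mathbf A-\mathcal L_{\bar{\mathcal G}}\otimes(BK),\qquad \mathbf A_0=\mathbf I_N\otimes(\mathbf A-G^\top C)$$ are Hurwitz, let $c_1\in(0,1)$, and let $\mathbf P_c,\mathbf P_0$ be symmetric positive definite with $$c_1(\mathbf P_c\mathbf A_c+\mathbf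 A_c^\top\mathbf P_c)\le-2\mathbf I_{nN},\qquad \mathbf P_0\mathbf A_0+\mathbf A_0^\top\mathbf P_0\le-\mathbf I_{nN}.$$ Put $\mathbf A_g=\mathbf I_N\otimes(G^\top C)$, and let $|\cdot|$ be the Euclidean norm of a vector and the Frobenius norm of a matrix. Let $\varrho_{k,j}$ (growth rates), $\Delta_{\theta_k}\in(0,1)$, $t_f>0$ and $\delta>0$ be given, with $$0<\max\{\Delta_{\theta_1},\dots,\Delta_{\theta_N}\}\le \frac1{|\mathbf P_c\mathbf A_g|}.$$ **Closed loop.** For $b>0$ let $r(t)=b\,\alpha_0(t)$ with $\alpha_0(t)=\frac1{t_f+\delta-t}$ on $[0,t_f)$ and $\alpha_0(t)=\frac1\delta$ on $[t_f,\infty)$. The leader has state $x_0$ with $\dot x_0=\mathbf Ax_0+F_0(t,x_0)$ on $[0,\infty)$; follower $k$ has state $x_k$, nonlinearity $F_k=(f_{k,1},\dots,f_{k,n})^\top$ and sensor sensitivity $\theta_k$; $\hat x_0,\hat x_k$ are observer states. With $e_k=x_k-x_0$, $\hat\eta_k=\mathbf\Lambda_r(\hat x_k-\hat x_0)$, $\varepsilon_k=\mathbf\Lambda_r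 e_k-\hat\eta_k$, $\Phi_k=\big(r^{n-i}(f_{k,i}(t,x_k)-f_{0,i}(t,x_0))\big)_{i=1}^n$ and the protocol $$u_k=-K\mathbf\Lambda_r\Big(\sum_{j=1}^N a_{k,j}(\hat x_k-\hat x_j)+\mathsf b_k(\hat x_k-\hat x_0)\Big),$$ the closed loop is the system, for $k=1,\dots,N$, $$\dot{\hat\eta}_k=r\big(\mathbf A\hat\eta_k+Bu_k+G^\top\theta_k\varepsilon_{k,1}+G^\top(\theta_k-1)\hat\eta_{k,1}\big)+\tfrac{\dot r}{r}\mathbf D_c\hat\eta_k,\qquad \dot\varepsilon_k=r\big((\mathbf A-G^\top C)\varepsilon_k+\Phi_k\big)+\tfrac{\dot r}{r}\mathbf D_c\varepsilon_k .$$ Solutions on an interval $[t_0,S)$, $S\le\infty$, are such that all $\hat\eta_k,\varepsilon_k$ are continuous and satisfy the equations for all $t\in(t_0,S)$ outside a set of times that is finite in every bounded interval. It is assumed that, for all $t\ge0$, all $k$, $i$ and all $\xi\in\mathbb R^n$, $$|f_{k,i}(t,\xi)-f_{0,i}(t,x_0(t))|\le\sum_{j=1}^i\varrho_{k,j}|\xi_j-x_{0,j}(t)|,$$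 and that each $\theta_k$ is continuous with $\theta_k(t)\in[1-\Delta_{\theta_k},1+\Delta_{\theta_k}]$. Let $V=\hat\eta^\top\mathbf P_c\hat\eta+c\,\varepsilon^\top\mathbf P_0\varepsilon$, where $\hat\eta$ and $\varepsilon$ stack the $\hat\eta_k$ and the $\varepsilon_k$. **Theorem 3.** There is $c>0$ such that for every $\gamma>0$ there is $b\ge t_f+\delta$ for which the following holds for all $F_0,F_k,\theta_k$ and leader trajectories $x_0$ as above. 1) The closed loop is (globally, uniformly) asymptotically stable on $[0,\infty)$: there is a class $\mathcal{KL}$ function $\beta$, the same for all these data, such that every solution on an interval $[t_0,S)$, $0\le t_0$, $S\le\infty$, satisfies $|(\hat\eta,\varepsilon)(t)|\le\beta\big(|(\hat\eta,\varepsilon)(t_0)|,t-t_0\big)$ for all $t\in[t_0,S)$. 2) For every solution on $[0,S)$ with $S>t_f$ and every $k$, the tracking error $e_k$ converges as $t\to t_f$ to the compact set $$\Omega=\left\{e\in\mathbb R^n:\ |e|\le\frac{2\delta\sqrt{V(0)}\,\big(\frac{\delta}{t_f+\delta}\big)^{\gamma/2}}{b\sqrt{\min\{\lambda_{\min}(\mathbf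 P_c),\,c\,\lambda_{\min}(\mathbf P_0)\}}}\right\},$$ and $e_k(t)\in\Omega$ for all $t\in[t_f,S)$. -/

import Mathlib

open Filter Topology Set Matrix
open scoped Kronecker

noncomputable section

namespace PrescribedTime

/-! ### Matrices of the agents and of the network.
Stacked vectors are indexed by `(k, i)`, `k` the follower and `i` the coordinate. Coordinates are
numbered from `0`, so the `i`-th coordinate of the usual numbering has index `i - 1`. -/

/-- The `n × n` matrix `A` of a chain of integrators: ones on the superdiagonal. -/
def chainA (n : ℕ) : Matrix (Fin n) (Fin n) ℝ :=
  Matrix.of fun i j => if (j : ℕ) = (i : ℕ) + 1 then 1 else 0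

/-- The input vector `B = (0, …, 0, 1)ᵀ`. -/
def inputB (n : ℕ) : Fin n → ℝ := fun i => if (i : ℕ) + 1 = n then 1 else 0

/-- The output row `C = (1, 0, …, 0)`. -/
def outputC (n : ℕ) [NeZero n] : Fin n → ℝ := Pi.single 0 1

/-- `Λ_r = diag(rⁿ, rⁿ⁻¹, …, r)`. -/
def scaling (n : ℕ) (r : ℝ) : Matrix (Fin n) (Fin n) ℝ :=
  Matrix.diagonal fun i => r ^ (n - (i : ℕ))

/-- `D_c = diag(n, n - 1, …, 1)`. -/
def weightD (n : ℕ) : Matrix (Fin n) (Fin n) ℝ :=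
  Matrix.diagonal fun i => (n : ℝ) - (i : ℕ)

/-- The Laplacian of the follower graph plus the diagonal 0-1 matrix of the followers that are
neighbours of the leader (those in `pin`). -/
def leaderLaplacian {N : ℕ} (Gr : SimpleGraph (Fin N)) [DecidableRel Gr.Adj]
    (pin : Finset (Fin N)) : Matrix (Fin N) (Fin N) ℝ :=
  Gr.lapMatrix ℝ + Matrix.diagonal fun k => if k ∈ pin then 1 else 0

/-- `A_c = I_N ⊗ A - L ⊗ (B K)`. -/
def closedA {N n : ℕ} (Gr : SimpleGraph (Fin N)) [DecidableRel Gr.Adj]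
    (pin : Finset (Fin N)) (K : Fin n → ℝ) :
    Matrix (Fin N × Fin n) (Fin N × Fin n) ℝ :=
  (1 : Matrix (Fin N) (Fin N) ℝ) ⊗ₖ chainA n
    - leaderLaplacian Gr pin ⊗ₖ Matrix.vecMulVec (inputB n) K

/-- `A_0 = I_N ⊗ (A - Gᵀ C)`. -/
def observerA (N : ℕ) {n : ℕ} [NeZero n] (G : Fin n → ℝ) :
    Matrix (Fin N × Fin n) (Fin N × Fin n) ℝ :=
  (1 : Matrix (Fin N) (Fin N) ℝ) ⊗ₖ (chainA n - Matrix.vecMulVec G (outputC n))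

/-- `A_g`, block diagonal with `N` blocks `[Gᵀ, 0, …, 0]`. -/
def gainA (N : ℕ) {n : ℕ} [NeZero n] (G : Fin n → ℝ) :
    Matrix (Fin N × Fin n) (Fin N × Fin n) ℝ :=
  (1 : Matrix (Fin N) (Fin N) ℝ) ⊗ₖ Matrix.vecMulVec G (outputC n)

/-- All complex eigenvalues have negative real part. -/
def IsHurwitz {ι : Type*} [Fintype ι] [DecidableEq ι] (M : Matrix ι ι ℝ) : Prop :=
  ∀ z ∈ spectrum ℂ (M.map (algebraMap ℝ ℂ)), z.re < 0

/-- Frobenius norm. -/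
def frobNorm {ι κ : Type*} [Fintype ι] [Fintype κ] (M : Matrix ι κ ℝ) : ℝ :=
  Real.sqrt (∑ i, ∑ j, M i j ^ 2)

/-- Smallest eigenvalue of a symmetric matrix. -/
def lambdaMin {ι : Type*} [Fintype ι] [DecidableEq ι] {M : Matrix ι ι ℝ}
    (hM : M.IsHermitian) : ℝ :=
  ⨅ i, hM.eigenvalues i

/-! ### The time-varying gain -/

/-- The saturated function `α₀`. -/
def alphaSat (tf δ t : ℝ) : ℝ := if t < tf then 1 / (tf + δ - t) else 1 / δ

/-- The gain `r = b α₀`. -/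
def gain (b tf δ t : ℝ) : ℝ := b * alphaSat tf δ t

/-! ### Signals, assumptions, closed loop -/

/-- State of the leader, states of the followers, and the corresponding observer states. -/
structure Signals (N n : ℕ) where
  x₀ : ℝ → Fin n → ℝ
  xhat₀ : ℝ → Fin n → ℝ
  x : Fin N → ℝ → Fin n → ℝ
  xhat : Fin N → ℝ → Fin n → ℝ

/-- A set of times that meets every bounded interval in a finite set. -/
def IsLocallyFinite (E : Set ℝ) : Prop := ∀ a b : ℝ, (E ∩ Icc a b).Finite

/-- The leader moves by `ẋ₀ = A x₀ + F₀(t, x₀)` on `[0, ∞)`, in the sense appropriate to a right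
hand side that is piecewise continuous in time. -/
def IsLeaderTrajectory {n : ℕ} (F₀ : ℝ → (Fin n → ℝ) → Fin n → ℝ) (x₀ : ℝ → Fin n → ℝ) : Prop :=
  ContinuousOn x₀ (Ici 0) ∧ ∃ E : Set ℝ, IsLocallyFinite E ∧
    ∀ t, 0 < t → t ∉ E → HasDerivAt x₀ (chainA n *ᵥ x₀ t + F₀ t (x₀ t)) t

/-- Growth assumption on the nonlinearities: for every time and every state `ξ` of follower `k`,
compared with the leader at that time. -/
def GrowthBound {N n : ℕ} (ϱ : Fin N → Fin n → ℝ) (F₀ : ℝ → (Fin n → ℝ) → Fin n → ℝ)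
    (F : Fin N → ℝ → (Fin n → ℝ) → Fin n → ℝ) (x₀ : ℝ → Fin n → ℝ) : Prop :=
  ∀ t, 0 ≤ t → ∀ k ξ i,
    |F k t ξ i - F₀ t (x₀ t) i| ≤ ∑ j ∈ Finset.Iic i, ϱ k j * |ξ j - x₀ t j|

/-- The sensor sensitivities are continuous with values in `[1 - Δ_k, 1 + Δ_k]`. -/
def SensitivityBound {N : ℕ} (Δ : Fin N → ℝ) (θ : Fin N → ℝ → ℝ) : Prop :=
  ∀ k, ContinuousOn (θ k) (Ici 0) ∧ ∀ t, 0 ≤ t → θ k t ∈ Icc (1 - Δ k) (1 + Δ k)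

section ClosedLoop

variable {N n : ℕ}

/-- Tracking error `e_k = x_k - x₀`. -/
def trackingError (s : Signals N n) (k : Fin N) (t : ℝ) : EuclideanSpace ℝ (Fin n) :=
  WithLp.toLp 2 (s.x k t - s.x₀ t)

/-- `η̂_k = Λ_r (x̂_k - x̂₀)`, for the time-varying gain `r`. -/
def etaHat (r : ℝ → ℝ) (s : Signals N n) (k : Fin N) (t : ℝ) : Fin n → ℝ :=
  scaling n (r t) *ᵥ (s.xhat k t - s.xhat₀ t)

/-- `ε_k = Λ_r (x_k - x₀) - η̂_k`. -/
def epsErr (r : ℝ → ℝ) (s : Signals N n) (k : Fin N) (t : ℝ) : Fin n → ℝ :=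
  scaling n (r t) *ᵥ (s.x k t - s.x₀ t) - etaHat r s k t

/-- The distributed protocol
`u_k = -K Λ_r (∑ⱼ a_{kj} (x̂_k - x̂_j) + b_k (x̂_k - x̂₀))`. -/
def control (Gr : SimpleGraph (Fin N)) [DecidableRel Gr.Adj] (pin : Finset (Fin N))
    (K : Fin n → ℝ) (r : ℝ → ℝ) (s : Signals N n) (k : Fin N) (t : ℝ) : ℝ :=
  -(K ⬝ᵥ (scaling n (r t) *ᵥ
      ((∑ j, Gr.adjMatrix ℝ k j • (s.xhat k t - s.xhat j t))
        + (if k ∈ pin then (1 : ℝ) else 0) • (s.xhat k t - s.xhat₀ t))))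

/-- `Φ_k`, with components `r^{n-i} (f_{k,i}(t, x_k) - f_{0,i}(t, x₀))`, `i = 1, …, n`. -/
def phi (F₀ : ℝ → (Fin n → ℝ) → Fin n → ℝ) (F : Fin N → ℝ → (Fin n → ℝ) → Fin n → ℝ)
    (r : ℝ → ℝ) (s : Signals N n) (k : Fin N) (t : ℝ) : Fin n → ℝ :=
  fun i => r t ^ (n - 1 - (i : ℕ)) * (F k t (s.x k t) i - F₀ t (s.x₀ t) i)

/-- The signals follow the closed-loop dynamics on `[t₀, S)`, `S ≤ ∞`. The equations are written
in the original time `t`; where the gain is not saturated, `dτ/dt = α₀ = ṙ / r` turns them into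
`dη̂_k/dτ = b (A η̂_k + B u_k) + D_c η̂_k + b Gᵀ θ_k ε_{k,1} + b Gᵀ (θ_k - 1) η̂_{k,1}` and
`dε_k/dτ = b ((A - Gᵀ C) ε_k + Φ_k) + D_c ε_k`; where it is saturated, `ṙ = 0`.
The equations may fail at a locally finite set of times (such as the corner of the gain and the
jumps of the nonlinearities), where the errors are still continuous. -/
def IsClosedLoop [NeZero n] (Gr : SimpleGraph (Fin N)) [DecidableRel Gr.Adj]
    (pin : Finset (Fin N)) (K G : Fin n → ℝ) (F₀ : ℝ → (Fin n → ℝ) → Fin n → ℝ)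
    (F : Fin N → ℝ → (Fin n → ℝ) → Fin n → ℝ) (θ : Fin N → ℝ → ℝ) (r : ℝ → ℝ)
    (t₀ : ℝ) (S : EReal) (s : Signals N n) : Prop :=
  (∀ k, ContinuousOn (etaHat r s k) {t | t₀ ≤ t ∧ (t : EReal) < S} ∧
    ContinuousOn (epsErr r s k) {t | t₀ ≤ t ∧ (t : EReal) < S}) ∧
  ∃ E : Set ℝ, IsLocallyFinite E ∧ ∀ t, t₀ < t → (t : EReal) < S → t ∉ E → ∀ k,
    HasDerivAt (etaHat r s k)
      (r t • (chainA n *ᵥ etaHat r s k t + control Gr pin K r s k t • inputB n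
          + (θ k t * epsErr r s k t 0) • G + ((θ k t - 1) * etaHat r s k t 0) • G)
        + (deriv r t / r t) • (weightD n *ᵥ etaHat r s k t)) t ∧
    HasDerivAt (epsErr r s k)
      (r t • ((chainA n - Matrix.vecMulVec G (outputC n)) *ᵥ epsErr r s k t + phi F₀ F r s k t)
        + (deriv r t / r t) • (weightD n *ᵥ epsErr r s k t)) t

/-- Euclidean norm of the closed-loop state `(η̂, ε)`. -/
def stateNorm (r : ℝ → ℝ) (s : Signals N n) (t : ℝ) : ℝ :=
  Real.sqrt (∑ k, ∑ i, (etaHat r s k t i ^ 2 + epsErr r s k t i ^ 2))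

/-- `V = η̂ᵀ P_c η̂ + c εᵀ P₀ ε`, with `η̂` and `ε` stacked over the followers. -/
def lyapV (Pc P₀ : Matrix (Fin N × Fin n) (Fin N × Fin n) ℝ) (c : ℝ)
    (r : ℝ → ℝ) (s : Signals N n) (t : ℝ) : ℝ :=
  (fun p : Fin N × Fin n => etaHat r s p.1 t p.2) ⬝ᵥ
      (Pc *ᵥ fun p : Fin N × Fin n => etaHat r s p.1 t p.2)
    + c * ((fun p : Fin N × Fin n => epsErr r s p.1 t p.2) ⬝ᵥ
      (P₀ *ᵥ fun p : Fin N × Fin n => epsErr r s p.1 t p.2))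

end ClosedLoop

/-- Class `𝒦ℒ` functions on `[0, ∞) × [0, ∞)`. -/
structure IsClassKL (β : ℝ → ℝ → ℝ) : Prop where
  continuousOn : ContinuousOn (fun p : ℝ × ℝ => β p.1 p.2) (Ici 0 ×ˢ Ici 0)
  zero : ∀ τ, 0 ≤ τ → β 0 τ = 0
  strictMonoOn : ∀ τ, 0 ≤ τ → StrictMonoOn (fun ρ => β ρ τ) (Ici 0)
  antitoneOn : ∀ ρ, 0 ≤ ρ → AntitoneOn (β ρ) (Ici 0)
  tendsto : ∀ ρ, 0 ≤ ρ → Tendsto (β ρ) atTop (𝓝 0)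

/-- The radius of the ball that the tracking errors enter. -/
def radius (b c tf δ γ lamc lam0 V0 : ℝ) : ℝ :=
  2 * δ * Real.sqrt V0 * (δ / (tf + δ)) ^ (γ / 2) / (b * Real.sqrt (min lamc (c * lam0)))

end PrescribedTime

end

/-! Everything rests on one differential inequality, `V' ≤ -γ α₀ V`, valid off a locally finite set
of times once `b` is large (`exists_gain_dissipation`).

Differentiate `V` along the stacked system and write `q = ṙ/r`. The `c₁`-inequality bounds the drift
term of `η̂` by `-c₁⁻¹|η̂|² = -(1 + μ)|η̂|²` with `μ = c₁⁻¹ - 1 > 0`. The unit part pays for the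
sensor error `(θ - 1)η̂`, since `Δ ≤ 1/|P_c A_g|`. The surplus `μ` and the weight `c` on the
observer error pay, by Young's inequality, for the coupling `θ ε` (`dissipation_real`). What is left
is a dissipation of order `r = b α₀`, against two perturbations: the weights `D_c`, entering with `q
≤ α₀`, and the nonlinearity. The triangular growth bound and `r ≥ 1` make `r Φ` Lipschitz in `(η̂,
ε)` with a constant independent of `r` (`abs_gain_mul_phi_le`), and `1 ≤ (t_f + δ) α₀`. Both
perturbations are thus of order `α₀` with constants free of `b`, and a large `b` dominates them.

Integrating with `α₀ ≥ 1/(t_f + δ)` gives an exponential, hence `𝒦ℒ`, bound. Integrating exactly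
over `[0, t_f]`, where `∫ α₀ = log((t_f + δ)/δ)`, gives `V(t_f) ≤ V(0) (δ/(t_f + δ))^γ`. Finally
`Λ_r e_k = η̂_k + ε_k` and `r ≥ 1` give `|e_k| ≤ 2|(η̂, ε)|/r`, with `r = b/δ` from `t_f` on
(`norm_trackingError_le`). -/

namespace PrescribedTime

/-! ### Quadratic forms -/

section Quadratic

variable {ι κ : Type*} [Fintype ι] [Fintype κ]

/-- Euclidean norm of a vector given by its coordinates. -/
noncomputable def euclNorm (x : ι → ℝ) : ℝ := Real.sqrt (∑ p, x p ^ 2)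

lemma euclNorm_nonneg (x : ι → ℝ) : 0 ≤ euclNorm x := Real.sqrt_nonneg _

lemma euclNorm_sq (x : ι → ℝ) : euclNorm x ^ 2 = ∑ p, x p ^ 2 :=
  Real.sq_sqrt (Finset.sum_nonneg fun _ _ => sq_nonneg _)

lemma dotProduct_self_eq_euclNorm_sq (x : ι → ℝ) : x ⬝ᵥ x = euclNorm x ^ 2 := by
  rw [euclNorm_sq]; exact Finset.sum_congr rfl fun p _ => (sq (x p)).symm

lemma abs_dotProduct_le_euclNorm_mul (x y : ι → ℝ) : |x ⬝ᵥ y| ≤ euclNorm x * euclNorm y := by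
  apply abs_le_of_sq_le_sq _ (mul_nonneg (euclNorm_nonneg x) (euclNorm_nonneg y))
  rw [mul_pow, euclNorm_sq, euclNorm_sq]
  exact Finset.sum_mul_sq_le_sq_mul_sq _ _ _

lemma frobNorm_nonneg (M : Matrix ι κ ℝ) : 0 ≤ frobNorm M := Real.sqrt_nonneg _

lemma euclNorm_mulVec_le (M : Matrix ι κ ℝ) (x : κ → ℝ) :
    euclNorm (M *ᵥ x) ≤ frobNorm M * euclNorm x := by
  apply le_of_sq_le_sq _ (mul_nonneg (frobNorm_nonneg M) (euclNorm_nonneg x))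
  have hM : frobNorm M ^ 2 = ∑ i, ∑ j, M i j ^ 2 :=
    Real.sq_sqrt (Finset.sum_nonneg fun _ _ => Finset.sum_nonneg fun _ _ => sq_nonneg _)
  rw [mul_pow, euclNorm_sq, euclNorm_sq, hM, Finset.sum_mul]
  exact Finset.sum_le_sum fun i _ => Finset.sum_mul_sq_le_sq_mul_sq _ _ _

lemma abs_dotProduct_mulVec_le (M : Matrix ι κ ℝ) (x : ι → ℝ) (y : κ → ℝ) :
    |x ⬝ᵥ M *ᵥ y| ≤ frobNorm M * euclNorm x * euclNorm y := by
  refine (abs_dotProduct_le_euclNorm_mul _ _).trans ?_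
  have := mul_le_mul_of_nonneg_left (euclNorm_mulVec_le M y) (euclNorm_nonneg x)
  linarith

lemma euclNorm_le_of_abs_le {x y : ι → ℝ} {a : ℝ} (ha : 0 ≤ a) (h : ∀ p, |x p| ≤ a * |y p|) :
    euclNorm x ≤ a * euclNorm y := by
  apply le_of_sq_le_sq _ (mul_nonneg ha (euclNorm_nonneg y))
  rw [mul_pow, euclNorm_sq, euclNorm_sq, Finset.mul_sum]
  refine Finset.sum_le_sum fun p _ => ?_
  rw [← sq_abs (x p), ← sq_abs (y p), ← mul_pow]
  exact pow_le_pow_left₀ (abs_nonneg _) (h p) 2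

lemma euclNorm_le_of_abs_le_const {x : ι → ℝ} {a : ℝ} (ha : 0 ≤ a) (h : ∀ p, |x p| ≤ a) :
    euclNorm x ≤ Fintype.card ι * a := by
  apply le_of_sq_le_sq _ (by positivity)
  rw [euclNorm_sq]
  have h1 : ∑ p, x p ^ 2 ≤ Fintype.card ι * a ^ 2 := by
    have := Finset.sum_le_card_nsmul Finset.univ (fun p => x p ^ 2) (a ^ 2)
      fun p _ => sq_le_sq' (by linarith [(abs_le.1 (h p)).1]) (abs_le.1 (h p)).2
    simpa [Finset.card_univ] using this
  -- The sharp factor is the square root of the cardinality; the cruder one avoids roots.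
  have h2 : (Fintype.card ι : ℝ) ≤ (Fintype.card ι : ℝ) ^ 2 := by
    exact_mod_cast Nat.le_self_pow two_ne_zero _
  rw [mul_pow]
  nlinarith [sq_nonneg a]

lemma abs_apply_le_euclNorm (x : ι → ℝ) (p : ι) : |x p| ≤ euclNorm x := by
  apply abs_le_of_sq_le_sq _ (euclNorm_nonneg x)
  rw [euclNorm_sq]
  exact Finset.single_le_sum (f := fun p => x p ^ 2) (fun _ _ => sq_nonneg _) (Finset.mem_univ p)

lemma dotProduct_mulVec_comm_of_isHermitian {P : Matrix ι ι ℝ} (hP : P.IsHermitian)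
    (x y : ι → ℝ) : x ⬝ᵥ P *ᵥ y = y ⬝ᵥ P *ᵥ x := by
  have hPt : Pᵀ = P := by simpa [conjTranspose_eq_transpose_of_trivial] using hP.eq
  rw [← dotProduct_transpose_mulVec, hPt]

/-- The two summands are transposes of each other. This turns the matrix inequalities into bounds on
the drift terms of `V'`. -/
lemma dotProduct_lyapunov {P A : Matrix ι ι ℝ} (hP : P.IsHermitian) (x : ι → ℝ) :
    x ⬝ᵥ (P * A + Aᵀ * P) *ᵥ x = 2 * (x ⬝ᵥ (P * A) *ᵥ x) := by
  have hPt : Pᵀ = P := by simpa [conjTranspose_eq_transpose_of_trivial] using hP.eq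
  have : Aᵀ * P = (P * A)ᵀ := by rw [transpose_mul, hPt]
  rw [this, add_mulVec, dotProduct_add, dotProduct_transpose_mulVec, two_mul]

lemma hasDerivAt_quadForm {P : Matrix ι ι ℝ} (hP : P.IsHermitian) {x : ℝ → ι → ℝ} {x' : ι → ℝ}
    {t : ℝ} (hx : HasDerivAt x x' t) :
    HasDerivAt (fun s => x s ⬝ᵥ P *ᵥ x s) (2 * (x t ⬝ᵥ P *ᵥ x')) t := by
  have hp := hasDerivAt_pi.1 hx
  have h : HasDerivAt (fun s => x s ⬝ᵥ P *ᵥ x s)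
      (∑ p, (x' p * (P *ᵥ x t) p + x t p * (P *ᵥ x') p)) t :=
    HasDerivAt.fun_sum fun p _ => (hp p).mul
      (HasDerivAt.fun_sum fun q _ => (hp q).const_mul (P p q))
  convert h using 1
  rw [Finset.sum_add_distrib, two_mul]
  congr 1
  exact dotProduct_mulVec_comm_of_isHermitian hP _ _

variable [DecidableEq ι]

lemma lambdaMin_pos [Nonempty ι] {M : Matrix ι ι ℝ} (hM : M.PosDef) :
    0 < lambdaMin hM.isHermitian := by
  obtain ⟨i, hi⟩ := exists_eq_ciInf_of_finite (f := hM.isHermitian.eigenvalues)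
  rw [lambdaMin, ← hi]
  exact hM.eigenvalues_pos i

/-- Subtracting `lambdaMin` times the identity shifts the spectrum, leaving nonnegative eigenvalues
and so a positive semidefinite matrix. -/
lemma lambdaMin_mul_euclNorm_sq_le {M : Matrix ι ι ℝ} (hM : M.IsHermitian) (x : ι → ℝ) :
    lambdaMin hM * euclNorm x ^ 2 ≤ x ⬝ᵥ M *ᵥ x := by
  have hH : (M - algebraMap ℝ _ (lambdaMin hM)).IsHermitian := by
    refine hM.sub ?_
    simp [Algebra.algebraMap_eq_smul_one, IsHermitian]
  have hS : (M - algebraMap ℝ _ (lambdaMin hM)).PosSemidef := by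
    rw [hH.posSemidef_iff_eigenvalues_nonneg]
    intro i
    have h1 := hH.eigenvalues_mem_spectrum_real i
    have h2 : hH.eigenvalues i + lambdaMin hM ∈ spectrum ℝ M := by
      have := spectrum.add_mem_add_iff (s := lambdaMin hM) |>.2 h1
      simpa [add_comm] using this
    rw [hM.spectrum_real_eq_range_eigenvalues] at h2
    obtain ⟨j, hj⟩ := h2
    have h3 : lambdaMin hM ≤ hM.eigenvalues j := ciInf_le (finite_range _).bddBelow j
    simp only [Pi.zero_apply]
    linarith
  have := hS.dotProduct_mulVec_nonneg x
  rw [star_trivial, sub_mulVec, dotProduct_sub, Algebra.algebraMap_eq_smul_one, smul_mulVec,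
    one_mulVec, dotProduct_smul, dotProduct_self_eq_euclNorm_sq, smul_eq_mul] at this
  linarith

end Quadratic

/-! ### Comparison -/

/-- Induction on the exceptional set: an exceptional point inside the interval splits it in two, and
continuity lets the two estimates be chained. -/
lemma le_of_hasDerivAt_nonpos_off_finite {f : ℝ → ℝ} {E : Set ℝ} (hE : E.Finite) :
    ∀ {a b : ℝ}, a ≤ b → ContinuousOn f (Icc a b) →
      (∀ t ∈ Ioo a b, t ∉ E → ∃ f', HasDerivAt f f' t ∧ f' ≤ 0) → f b ≤ f a := by
  induction E, hE using Set.Finite.induction_on with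
  | empty =>
    intro a b hab hc hd
    refine antitoneOn_of_deriv_nonpos (convex_Icc a b) hc ?_ ?_ (left_mem_Icc.2 hab)
      (right_mem_Icc.2 hab) hab
    · intro t ht
      rw [interior_Icc] at ht
      obtain ⟨f', hf, -⟩ := hd t ht (notMem_empty t)
      exact hf.differentiableAt.differentiableWithinAt
    · intro t ht
      rw [interior_Icc] at ht
      obtain ⟨f', hf, h0⟩ := hd t ht (notMem_empty t)
      rwa [hf.deriv]
  | @insert c E hc hE ih =>
    intro a b hab hcont hd
    by_cases hcab : c ∈ Ioo a b
    · refine (ih hcab.2.le (hcont.mono (Icc_subset_Icc_left hcab.1.le)) fun t ht htE => ?_).trans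
        (ih hcab.1.le (hcont.mono (Icc_subset_Icc_right hcab.2.le)) fun t ht htE => ?_)
      · refine hd t ⟨hcab.1.trans ht.1, ht.2⟩ ?_
        rintro (rfl | h)
        exacts [lt_irrefl _ ht.1, htE h]
      · refine hd t ⟨ht.1, ht.2.trans hcab.2⟩ ?_
        rintro (rfl | h)
        exacts [lt_irrefl _ ht.2, htE h]
    · refine ih hab hcont fun t ht htE => hd t ht ?_
      rintro (rfl | h)
      exacts [hcab ht, htE h]

/-- Comparison lemma: `v' ≤ -w' v` off a finite set gives `v b ≤ v a * exp (w a - w b)`. -/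
lemma le_mul_exp_of_hasDerivAt_le {v w : ℝ → ℝ} {E : Set ℝ} (hE : E.Finite) {a b : ℝ}
    (hab : a ≤ b) (hv : ContinuousOn v (Icc a b)) (hw : ContinuousOn w (Icc a b))
    (hd : ∀ t ∈ Ioo a b, t ∉ E →
      ∃ v' w', HasDerivAt v v' t ∧ HasDerivAt w w' t ∧ v' ≤ -w' * v t) :
    v b ≤ v a * Real.exp (w a - w b) := by
  have key := le_of_hasDerivAt_nonpos_off_finite (f := fun t => v t * Real.exp (w t)) hE hab
    (hv.mul (Real.continuous_exp.comp_continuousOn hw)) fun t ht htE => by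
      obtain ⟨v', w', h1, h2, h3⟩ := hd t ht htE
      refine ⟨_, h1.mul h2.exp, ?_⟩
      -- The derivative of `v exp w` is `(v' + w' v) exp w`, which is nonpositive.
      have := Real.exp_pos (w t)
      nlinarith
  rw [Real.exp_sub, ← mul_div_assoc, le_div_iff₀ (Real.exp_pos _)]
  exact key

/-! ### Exponential bounds are of class `𝒦ℒ` -/

lemma isClassKL_mul_exp {M κ : ℝ} (hM : 0 < M) (hκ : 0 < κ) :
    IsClassKL fun ρ τ => M * ρ * Real.exp (-(κ * τ)) where
  continuousOn := by fun_prop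
  zero := by simp
  strictMonoOn τ _ a _ b _ hab := by
    have := Real.exp_pos (-(κ * τ))
    dsimp only
    gcongr
  antitoneOn ρ hρ a _ b _ hab := by
    dsimp only
    gcongr
  tendsto ρ _ := by
    have : Tendsto (fun τ => Real.exp (-(κ * τ))) atTop (𝓝 0) :=
      Real.tendsto_exp_neg_atTop_nhds_zero.comp (tendsto_id.const_mul_atTop hκ)
    simpa using this.const_mul (M * ρ)

/-! ### Dissipation inequality for the stacked system -/

section Dissipation

variable {ι : Type*} [Fintype ι] [DecidableEq ι]

/-- The scalar core. Here `h`, `e` stand for `|η̂|`, `|ε|` and `p` for `|P_c A_g|`; `x₁, …, x₄` are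
the drift, coupling, sensor and weight terms of `η̂`, and `y₁, y₂, y₃` the drift, nonlinear and
weight terms of `ε`. The factor `r` is already inside `y₂`, so the nonlinearity is not amplified by
the gain. -/
lemma dissipation_real {μ p c a₁ a₂ a₃ R h e r q x₁ x₂ x₃ x₄ y₁ y₂ y₃ : ℝ}
    (hμ : 0 < μ) (hc : c = 4 * p ^ 2 / μ + 1)
    (hr : 0 ≤ r) (hq : 0 ≤ q) (ha₃ : 0 ≤ a₃) (ha₁ : 0 ≤ a₁) (ha₂ : 0 ≤ a₂) (hR : 0 ≤ R)
    (h₁ : x₁ ≤ -(1 + μ) * h ^ 2) (h₂ : x₂ ≤ 2 * p * h * e) (h₃ : x₃ ≤ h ^ 2)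
    (h₄ : x₄ ≤ a₁ * h ^ 2)
    (h₅ : 2 * y₁ ≤ -e ^ 2) (h₆ : y₂ ≤ a₃ * e * (R * (h + e))) (h₇ : y₃ ≤ a₂ * e ^ 2) :
    2 * (r * (x₁ + x₂ + x₃) + q * x₄) + c * (2 * (r * y₁ + y₂ + q * y₃)) ≤
      -(r * min μ 1 - q * (2 * a₁ + 2 * c * a₂) - 4 * c * a₃ * R) * (h ^ 2 + e ^ 2) := by
  have hcμ : μ * (c - 1) = 4 * p ^ 2 := by rw [hc]; field_simp; ring
  have hc0 : 0 < c := by rw [hc]; positivity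
  -- The choice of `c` makes `μ (c - 1) = (2p)²`, so `μ` times the difference of the two sides is a
  -- perfect square. It spends `μ` of the available `2μ` and all but one of `c`.
  have hyoung : 4 * p * h * e ≤ μ * h ^ 2 + (c - 1) * e ^ 2 := by
    have : 0 ≤ μ * (μ * h ^ 2 + (c - 1) * e ^ 2 - 4 * p * h * e) := by
      have : μ * (μ * h ^ 2 + (c - 1) * e ^ 2 - 4 * p * h * e) = (μ * h - 2 * p * e) ^ 2 := by
        linear_combination e ^ 2 * hcμ
      rw [this]; positivity
    have := nonneg_of_mul_nonneg_right this hμ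
    linarith
  have hmain : 2 * (x₁ + x₂ + x₃) + c * (2 * y₁) ≤ -(min μ 1 * (h ^ 2 + e ^ 2)) := by
    have k1 : c * (2 * y₁) ≤ c * -e ^ 2 := mul_le_mul_of_nonneg_left h₅ hc0.le
    have k2 := mul_le_mul_of_nonneg_right (min_le_left μ 1) (sq_nonneg h)
    have k3 := mul_le_mul_of_nonneg_right (min_le_right μ 1) (sq_nonneg e)
    nlinarith
  have hy₂ : y₂ ≤ 2 * (a₃ * R) * (h ^ 2 + e ^ 2) := by
    have k : e * (h + e) ≤ 2 * (h ^ 2 + e ^ 2) := by nlinarith [sq_nonneg (h - e)]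
    have := mul_le_mul_of_nonneg_left k (mul_nonneg ha₃ hR)
    linarith
  have hx₄ : x₄ ≤ a₁ * (h ^ 2 + e ^ 2) := by nlinarith [mul_nonneg ha₁ (sq_nonneg e)]
  have hy₃ : y₃ ≤ a₂ * (h ^ 2 + e ^ 2) := by nlinarith [mul_nonneg ha₂ (sq_nonneg h)]
  have j1 := mul_le_mul_of_nonneg_left hmain hr
  have j2 := mul_le_mul_of_nonneg_left hy₂ hc0.le
  have j3 := mul_le_mul_of_nonneg_left hx₄ hq
  have j4 := mul_le_mul_of_nonneg_left hy₃ (mul_nonneg hc0.le hq)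
  linarith

lemma dissipation_stacked {Pc P₀ Ac A₀ Ag D : Matrix ι ι ℝ} (hPc : Pc.IsHermitian)
    (hP₀ : P₀.IsHermitian) {c₁ : ℝ} (hc₁ : 0 < c₁ ∧ c₁ < 1)
    (hPcA : (-(c₁ • (Pc * Ac + Acᵀ * Pc)) - (2 : ℝ) • 1).PosSemidef)
    (hP₀A : (-(P₀ * A₀ + A₀ᵀ * P₀) - 1).PosSemidef)
    {c : ℝ} (hc : c = 4 * frobNorm (Pc * Ag) ^ 2 / (c₁⁻¹ - 1) + 1)
    {R r q : ℝ} (hR : 0 ≤ R) (hr : 0 ≤ r) (hq : 0 ≤ q) {H Z X Y Ψ : ι → ℝ}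
    (hX : euclNorm X ≤ 2 * euclNorm Z) (hY : frobNorm (Pc * Ag) * euclNorm Y ≤ euclNorm H)
    (hΨ : euclNorm Ψ ≤ R * (euclNorm H + euclNorm Z)) :
    2 * (H ⬝ᵥ Pc *ᵥ (r • (Ac *ᵥ H + Ag *ᵥ X + Ag *ᵥ Y) + q • (D *ᵥ H)))
      + c * (2 * (Z ⬝ᵥ P₀ *ᵥ (r • (A₀ *ᵥ Z) + Ψ + q • (D *ᵥ Z)))) ≤
      -(r * min (c₁⁻¹ - 1) 1 - q * (2 * frobNorm (Pc * D) + 2 * c * frobNorm (P₀ * D))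
        - 4 * c * frobNorm P₀ * R) * (euclNorm H ^ 2 + euclNorm Z ^ 2) := by
  have hμ : 0 < c₁⁻¹ - 1 := sub_pos.2 ((one_lt_inv₀ hc₁.1).2 hc₁.2)
  simp only [mulVec_add, mulVec_smul, dotProduct_add, dotProduct_smul, mulVec_mulVec, smul_eq_mul]
  have hH := euclNorm_nonneg H
  have hZ := euclNorm_nonneg Z
  refine dissipation_real hμ hc hr hq (frobNorm_nonneg P₀) (frobNorm_nonneg _)
    (frobNorm_nonneg _) hR ?_ ?_ ?_ ?_ ?_ ?_ ?_
  · have := hPcA.dotProduct_mulVec_nonneg H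
    rw [star_trivial, sub_mulVec, neg_mulVec, smul_mulVec, smul_mulVec, one_mulVec, dotProduct_sub,
      dotProduct_neg, dotProduct_smul, dotProduct_smul, dotProduct_lyapunov hPc,
      dotProduct_self_eq_euclNorm_sq, smul_eq_mul, smul_eq_mul] at this
    have h2 : c₁ * (H ⬝ᵥ (Pc * Ac) *ᵥ H) ≤ -euclNorm H ^ 2 := by linarith
    have h3 := mul_le_mul_of_nonneg_left h2 (inv_nonneg.2 hc₁.1.le)
    rw [inv_mul_cancel_left₀ hc₁.1.ne'] at h3
    linarith
  · refine (le_abs_self _).trans ((abs_dotProduct_mulVec_le _ _ _).trans ?_)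
    have := mul_le_mul_of_nonneg_left hX (mul_nonneg (frobNorm_nonneg (Pc * Ag)) hH)
    linarith
  · refine (le_abs_self _).trans ((abs_dotProduct_mulVec_le _ _ _).trans ?_)
    have := mul_le_mul_of_nonneg_left hY hH
    linarith
  · refine (le_abs_self _).trans ((abs_dotProduct_mulVec_le _ _ _).trans ?_)
    exact le_of_eq (by ring)
  · have := hP₀A.dotProduct_mulVec_nonneg Z
    rw [star_trivial, sub_mulVec, neg_mulVec, one_mulVec, dotProduct_sub, dotProduct_neg,
      dotProduct_lyapunov hP₀, dotProduct_self_eq_euclNorm_sq] at this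
    linarith
  · refine (le_abs_self _).trans ((abs_dotProduct_mulVec_le _ _ _).trans ?_)
    exact mul_le_mul_of_nonneg_left hΨ (mul_nonneg (frobNorm_nonneg _) hZ)
  · refine (le_abs_self _).trans ((abs_dotProduct_mulVec_le _ _ _).trans ?_)
    exact le_of_eq (by ring)

end Dissipation

/-! ### Stacking the closed loop -/

section Stacking

variable {N n : ℕ}

lemma kronecker_mulVec_apply (M : Matrix (Fin N) (Fin N) ℝ) (Q : Matrix (Fin n) (Fin n) ℝ)
    (x : Fin N × Fin n → ℝ) (p : Fin N × Fin n) :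
    ((M ⊗ₖ Q) *ᵥ x) p = ∑ j, M p.1 j * (Q *ᵥ fun l => x (j, l)) p.2 := by
  simp only [mulVec, dotProduct, kroneckerMap_apply, Fintype.sum_prod_type, Finset.mul_sum,
    mul_assoc]

lemma one_kronecker_mulVec_apply (Q : Matrix (Fin n) (Fin n) ℝ)
    (x : Fin N × Fin n → ℝ) (p : Fin N × Fin n) :
    (((1 : Matrix (Fin N) (Fin N) ℝ) ⊗ₖ Q) *ᵥ x) p = (Q *ᵥ fun l => x (p.1, l)) p.2 := by
  rw [kronecker_mulVec_apply, Finset.sum_eq_single p.1]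
  · simp
  · intro j _ hj
    rw [one_apply_ne' hj, zero_mul]
  · simp

lemma vecMulVec_mulVec_apply (v w x : Fin n → ℝ) (i : Fin n) :
    (vecMulVec v w *ᵥ x) i = v i * (w ⬝ᵥ x) := by
  simp only [mulVec, dotProduct, vecMulVec_apply, Finset.mul_sum, mul_assoc]

lemma scaling_mulVec_apply (r : ℝ) (v : Fin n → ℝ) (i : Fin n) :
    (scaling n r *ᵥ v) i = r ^ (n - (i : ℕ)) * v i := by
  rw [scaling, mulVec_diagonal]

/-- The weights `D_c` of all followers. -/
noncomputable def stackedWeight (N n : ℕ) : Matrix (Fin N × Fin n) (Fin N × Fin n) ℝ :=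
  Matrix.diagonal fun p => (n : ℝ) - (p.2 : ℕ)

lemma stackedWeight_mulVec_apply (x : Fin N × Fin n → ℝ) (p : Fin N × Fin n) :
    (stackedWeight N n *ᵥ x) p = (weightD n *ᵥ fun l => x (p.1, l)) p.2 := by
  rw [stackedWeight, weightD, mulVec_diagonal, mulVec_diagonal]

/-- The stacked vector `η̂`. -/
noncomputable def stackedEta (r : ℝ → ℝ) (s : Signals N n) (t : ℝ) : Fin N × Fin n → ℝ :=
  fun p => etaHat r s p.1 t p.2

/-- The stacked vector `ε`. -/
noncomputable def stackedEps (r : ℝ → ℝ) (s : Signals N n) (t : ℝ) : Fin N × Fin n → ℝ :=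
  fun p => epsErr r s p.1 t p.2

lemma lyapV_eq (Pc P₀ : Matrix (Fin N × Fin n) (Fin N × Fin n) ℝ) (c : ℝ) (r : ℝ → ℝ)
    (s : Signals N n) (t : ℝ) :
    lyapV Pc P₀ c r s t = stackedEta r s t ⬝ᵥ Pc *ᵥ stackedEta r s t
      + c * (stackedEps r s t ⬝ᵥ P₀ *ᵥ stackedEps r s t) := rfl

lemma stateNorm_sq (r : ℝ → ℝ) (s : Signals N n) (t : ℝ) :
    stateNorm r s t ^ 2 = euclNorm (stackedEta r s t) ^ 2 + euclNorm (stackedEps r s t) ^ 2 := by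
  rw [stateNorm, Real.sq_sqrt (Finset.sum_nonneg fun _ _ => Finset.sum_nonneg fun _ _ => by
    positivity), euclNorm_sq, euclNorm_sq, ← Finset.sum_add_distrib, Fintype.sum_prod_type]
  rfl

lemma etaHat_add_epsErr (r : ℝ → ℝ) (s : Signals N n) (k : Fin N) (t : ℝ) (i : Fin n) :
    etaHat r s k t i + epsErr r s k t i = r t ^ (n - (i : ℕ)) * (s.x k t i - s.x₀ t i) := by
  rw [epsErr, Pi.sub_apply, scaling_mulVec_apply, Pi.sub_apply]
  ring

lemma leaderLaplacian_mulVec_apply (Gr : SimpleGraph (Fin N)) [DecidableRel Gr.Adj]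
    (pin : Finset (Fin N)) (k : Fin N) (y : Fin N → ℝ) :
    ∑ j, leaderLaplacian Gr pin k j * y j
      = (∑ j, Gr.adjMatrix ℝ k j * (y k - y j)) + (if k ∈ pin then (1 : ℝ) else 0) * y k := by
  have h1 : ∑ j, leaderLaplacian Gr pin k j * y j = (leaderLaplacian Gr pin *ᵥ y) k := rfl
  have h2 : (∑ j, Gr.adjMatrix ℝ k j) = Gr.degree k := by
    simp [SimpleGraph.adjMatrix_apply, SimpleGraph.degree_eq_sum_if_adj]
  have h3 : ∑ j, Gr.adjMatrix ℝ k j * y j = ∑ u ∈ Gr.neighborFinset k, y u := by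
    have := Gr.adjMatrix_mulVec_apply (α := ℝ) k y
    exact this
  rw [h1, leaderLaplacian, add_mulVec, Pi.add_apply, SimpleGraph.lapMatrix_mulVec_apply,
    mulVec_diagonal]
  simp only [mul_sub, Finset.sum_sub_distrib, ← Finset.sum_mul, h2, h3]

/-- The leader's observer state cancels in `x̂_k - x̂_j`, so the protocol depends on the `η̂_j`
alone, through the pinned Laplacian. This is what closes the stacked equation with the matrix
`closedA`. -/
lemma control_eq (Gr : SimpleGraph (Fin N)) [DecidableRel Gr.Adj] (pin : Finset (Fin N))
    (K : Fin n → ℝ) (r : ℝ → ℝ) (s : Signals N n) (k : Fin N) (t : ℝ) :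
    control Gr pin K r s k t
      = -∑ j, leaderLaplacian Gr pin k j * (K ⬝ᵥ etaHat r s j t) := by
  rw [leaderLaplacian_mulVec_apply, control]
  have h : ∀ j, scaling n (r t) *ᵥ (s.xhat k t - s.xhat j t)
      = etaHat r s k t - etaHat r s j t := by
    intro j
    rw [etaHat, etaHat, ← mulVec_sub]
    congr 1
    abel
  rw [mulVec_add, mulVec_sum, mulVec_smul, dotProduct_add, dotProduct_sum, dotProduct_smul]
  simp only [mulVec_smul, h, dotProduct_smul, dotProduct_sub, smul_eq_mul]
  rfl

lemma closedA_mulVec_stackedEta (Gr : SimpleGraph (Fin N)) [DecidableRel Gr.Adj]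
    (pin : Finset (Fin N)) (K : Fin n → ℝ) (r : ℝ → ℝ) (s : Signals N n) (t : ℝ)
    (p : Fin N × Fin n) :
    (closedA Gr pin K *ᵥ stackedEta r s t) p
      = (chainA n *ᵥ etaHat r s p.1 t) p.2 + control Gr pin K r s p.1 t * inputB n p.2 := by
  rw [closedA, sub_mulVec, Pi.sub_apply, one_kronecker_mulVec_apply, kronecker_mulVec_apply,
    control_eq, neg_mul, ← sub_eq_add_neg, Finset.sum_mul]
  congr 1
  refine Finset.sum_congr rfl fun j _ => ?_
  rw [vecMulVec_mulVec_apply]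
  have : (fun l => stackedEta r s t (j, l)) = etaHat r s j t := rfl
  rw [this]
  ring

lemma gainA_mulVec_apply [NeZero n] (G : Fin n → ℝ) (x : Fin N × Fin n → ℝ) (p : Fin N × Fin n) :
    (gainA N G *ᵥ x) p = x (p.1, 0) * G p.2 := by
  rw [gainA, one_kronecker_mulVec_apply, vecMulVec_mulVec_apply, outputC, single_dotProduct,
    one_mul, mul_comm]

end Stacking

/-! ### The gain -/

section Gain

variable {b tf δ t : ℝ}

/-- One formula for both regimes, from which continuity and the bounds on `α₀` can be read off. -/
lemma alphaSat_eq (tf δ t : ℝ) : alphaSat tf δ t = 1 / (tf + δ - min t tf) := by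
  rw [alphaSat]
  split_ifs with h
  · rw [min_eq_left h.le]
  · rw [min_eq_right (not_lt.1 h), add_sub_cancel_left]

lemma alphaSat_pos (hδ : 0 < δ) (t : ℝ) : 0 < alphaSat tf δ t := by
  rw [alphaSat_eq]
  have := min_le_right t tf
  exact one_div_pos.2 (by linarith)

lemma one_div_le_alphaSat (htf : 0 < tf) (hδ : 0 < δ) (ht : 0 ≤ t) :
    1 / (tf + δ) ≤ alphaSat tf δ t := by
  rw [alphaSat_eq]
  have h1 := min_le_right t tf
  have h2 : 0 ≤ min t tf := le_min ht htf.le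
  exact one_div_le_one_div_of_le (by linarith) (by linarith)

lemma one_le_gain (htf : 0 < tf) (hδ : 0 < δ) (hb : tf + δ ≤ b) (ht : 0 ≤ t) :
    1 ≤ gain b tf δ t := by
  have h1 := one_div_le_alphaSat htf hδ ht
  have h2 : 0 < tf + δ := by linarith
  rw [div_le_iff₀ h2] at h1
  have := mul_le_mul_of_nonneg_left hb (alphaSat_pos (tf := tf) hδ t).le
  rw [gain]
  linarith

lemma continuous_gain (hδ : 0 < δ) : Continuous (gain b tf δ) := by
  have : gain b tf δ = fun t => b * (1 / (tf + δ - min t tf)) := by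
    funext t; rw [gain, alphaSat_eq]
  rw [this]
  refine continuous_const.mul (continuous_const.div (by fun_prop) fun t => ?_)
  have := min_le_right t tf
  linarith

lemma deriv_gain_of_lt (hδ : 0 < δ) (hb : 0 < b) (ht : t < tf) :
    deriv (gain b tf δ) t / gain b tf δ t = alphaSat tf δ t := by
  have hne : tf + δ - t ≠ 0 := by linarith
  have h : HasDerivAt (fun u => b * (tf + δ - u)⁻¹) (b * (-(-1) / (tf + δ - t) ^ 2)) t :=
    (((hasDerivAt_id t).const_sub (tf + δ)).inv hne).const_mul b
  have he : gain b tf δ =ᶠ[𝓝 t] fun u => b * (tf + δ - u)⁻¹ := by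
    filter_upwards [eventually_lt_nhds ht] with u hu
    rw [gain, alphaSat, if_pos hu, one_div]
  rw [(h.congr_of_eventuallyEq he).deriv, gain, alphaSat, if_pos ht]
  field_simp

lemma deriv_gain_of_gt (ht : tf < t) : deriv (gain b tf δ) t / gain b tf δ t = 0 := by
  have he : gain b tf δ =ᶠ[𝓝 t] fun _ => b * (1 / δ) := by
    filter_upwards [eventually_gt_nhds ht] with u hu
    rw [gain, alphaSat, if_neg (not_lt.2 hu.le)]
  rw [he.deriv_eq, deriv_const, zero_div]

/-- Before `t_f` the quotient equals `α₀`, afterwards it vanishes. The bound does not involve `b`,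
so raising `b` strengthens the dissipation without strengthening this perturbation. -/
lemma deriv_gain_div_mem (hδ : 0 < δ) (hb : 0 < b) (ht : t ≠ tf) :
    deriv (gain b tf δ) t / gain b tf δ t ∈ Icc 0 (alphaSat tf δ t) := by
  have := (alphaSat_pos (tf := tf) hδ t).le
  rcases lt_or_gt_of_ne ht with h | h
  · rw [deriv_gain_of_lt hδ hb h]; exact ⟨this, le_rfl⟩
  · rw [deriv_gain_of_gt h]; exact ⟨le_rfl, this⟩

end Gain

section ClosedLoop

variable {N n : ℕ}

/-! ### The nonlinear terms -/

/-- The factor `r` raises the power in `Φ` to that of the `i`-th entry of `Λ_r`. Only `j ≤ i` occur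
in the growth bound, and for those `r ≥ 1` allows passing to the larger power in the `j`-th entry,
which reassembles `Λ_r e_k`. No power of `r` survives. -/
lemma abs_gain_mul_phi_le {ϱ : Fin N → Fin n → ℝ} {F₀ : ℝ → (Fin n → ℝ) → Fin n → ℝ}
    {F : Fin N → ℝ → (Fin n → ℝ) → Fin n → ℝ} {s : Signals N n} (hF : GrowthBound ϱ F₀ F s.x₀)
    {r : ℝ → ℝ} {t : ℝ} (ht : 0 ≤ t) (hr : 1 ≤ r t) (k : Fin N) (i : Fin n) :
    |r t * phi F₀ F r s k t i| ≤ ∑ j, |ϱ k j| * |etaHat r s k t j + epsErr r s k t j| := by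
  have hr0 : 0 < r t := by linarith
  have hpow : r t * r t ^ (n - 1 - (i : ℕ)) = r t ^ (n - (i : ℕ)) := by
    rw [← pow_succ']
    congr 1
    have := i.isLt
    omega
  rw [phi, ← mul_assoc, hpow, abs_mul, abs_of_pos (pow_pos hr0 _)]
  calc r t ^ (n - (i : ℕ)) * |F k t (s.x k t) i - F₀ t (s.x₀ t) i|
      ≤ r t ^ (n - (i : ℕ)) * ∑ j ∈ Finset.Iic i, ϱ k j * |s.x k t j - s.x₀ t j| :=
        mul_le_mul_of_nonneg_left (hF t ht k _ i) (pow_pos hr0 _).le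
    _ ≤ ∑ j ∈ Finset.Iic i, |ϱ k j| * |etaHat r s k t j + epsErr r s k t j| := by
        rw [Finset.mul_sum]
        refine Finset.sum_le_sum fun j hj => ?_
        rw [etaHat_add_epsErr, abs_mul, abs_of_pos (pow_pos hr0 _)]
        have hji : (j : ℕ) ≤ i := Fin.le_def.1 (Finset.mem_Iic.1 hj)
        have h1 : r t ^ (n - (i : ℕ)) ≤ r t ^ (n - (j : ℕ)) := pow_le_pow_right₀ hr (by omega)
        calc r t ^ (n - (i : ℕ)) * (ϱ k j * |s.x k t j - s.x₀ t j|)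
            ≤ r t ^ (n - (i : ℕ)) * (|ϱ k j| * |s.x k t j - s.x₀ t j|) := by
              gcongr; exact le_abs_self _
          _ ≤ r t ^ (n - (j : ℕ)) * (|ϱ k j| * |s.x k t j - s.x₀ t j|) := by gcongr
          _ = _ := by ring
    _ ≤ ∑ j, |ϱ k j| * |etaHat r s k t j + epsErr r s k t j| :=
        Finset.sum_le_sum_of_subset_of_nonneg (Finset.subset_univ _) fun _ _ _ => by positivity

/-- A bound for the growth of the stacked nonlinearity. -/
noncomputable def growthConst (ϱ : Fin N → Fin n → ℝ) : ℝ :=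
  Fintype.card (Fin N × Fin n) * ∑ k, ∑ j, |ϱ k j|

lemma growthConst_nonneg (ϱ : Fin N → Fin n → ℝ) : 0 ≤ growthConst ϱ := by
  rw [growthConst]; positivity

lemma euclNorm_gain_mul_phi_le {ϱ : Fin N → Fin n → ℝ} {F₀ : ℝ → (Fin n → ℝ) → Fin n → ℝ}
    {F : Fin N → ℝ → (Fin n → ℝ) → Fin n → ℝ} {s : Signals N n} (hF : GrowthBound ϱ F₀ F s.x₀)
    {r : ℝ → ℝ} {t : ℝ} (ht : 0 ≤ t) (hr : 1 ≤ r t) :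
    euclNorm (fun p : Fin N × Fin n => r t * phi F₀ F r s p.1 t p.2)
      ≤ growthConst ϱ * (euclNorm (stackedEta r s t) + euclNorm (stackedEps r s t)) := by
  have h1 := euclNorm_nonneg (stackedEta r s t)
  have h2 := euclNorm_nonneg (stackedEps r s t)
  rw [growthConst, mul_assoc]
  refine euclNorm_le_of_abs_le_const (by positivity) fun p =>
    (abs_gain_mul_phi_le hF ht hr p.1 p.2).trans ?_
  calc ∑ j, |ϱ p.1 j| * |etaHat r s p.1 t j + epsErr r s p.1 t j|
      ≤ ∑ j, |ϱ p.1 j| * (euclNorm (stackedEta r s t) + euclNorm (stackedEps r s t)) := by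
        refine Finset.sum_le_sum fun j _ => mul_le_mul_of_nonneg_left ?_ (abs_nonneg _)
        exact (abs_add_le _ _).trans (add_le_add
          (abs_apply_le_euclNorm (stackedEta r s t) (p.1, j))
          (abs_apply_le_euclNorm (stackedEps r s t) (p.1, j)))
    _ ≤ _ := by
        rw [← Finset.sum_mul]
        refine mul_le_mul_of_nonneg_right ?_ (add_nonneg h1 h2)
        exact Finset.single_le_sum (f := fun k => ∑ j, |ϱ k j|)
          (fun _ _ => Finset.sum_nonneg fun _ _ => abs_nonneg _) (Finset.mem_univ p.1)

/-! ### Bounds for the Lyapunov function -/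

lemma lyapV_le (Pc P₀ : Matrix (Fin N × Fin n) (Fin N × Fin n) ℝ) {c : ℝ} (hc : 0 ≤ c)
    (r : ℝ → ℝ) (s : Signals N n) (t : ℝ) :
    lyapV Pc P₀ c r s t ≤ (frobNorm Pc + c * frobNorm P₀) * stateNorm r s t ^ 2 := by
  rw [lyapV_eq, stateNorm_sq]
  have h1 := (le_abs_self _).trans
    (abs_dotProduct_mulVec_le Pc (stackedEta r s t) (stackedEta r s t))
  have h2 := mul_le_mul_of_nonneg_left ((le_abs_self _).trans
    (abs_dotProduct_mulVec_le P₀ (stackedEps r s t) (stackedEps r s t))) hc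
  have h3 := mul_nonneg (frobNorm_nonneg Pc) (sq_nonneg (euclNorm (stackedEps r s t)))
  have h4 := mul_nonneg (mul_nonneg hc (frobNorm_nonneg P₀))
    (sq_nonneg (euclNorm (stackedEta r s t)))
  linarith

lemma min_lambdaMin_mul_le_lyapV {Pc P₀ : Matrix (Fin N × Fin n) (Fin N × Fin n) ℝ}
    (hPc : Pc.IsHermitian) (hP₀ : P₀.IsHermitian) {c : ℝ} (hc : 0 ≤ c)
    (r : ℝ → ℝ) (s : Signals N n) (t : ℝ) :
    min (lambdaMin hPc) (c * lambdaMin hP₀) * stateNorm r s t ^ 2 ≤ lyapV Pc P₀ c r s t := by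
  rw [lyapV_eq, stateNorm_sq]
  have h1 := lambdaMin_mul_euclNorm_sq_le hPc (stackedEta r s t)
  have h2 := mul_le_mul_of_nonneg_left (lambdaMin_mul_euclNorm_sq_le hP₀ (stackedEps r s t)) hc
  have h3 := mul_le_mul_of_nonneg_right (min_le_left (lambdaMin hPc) (c * lambdaMin hP₀))
    (sq_nonneg (euclNorm (stackedEta r s t)))
  have h4 := mul_le_mul_of_nonneg_right (min_le_right (lambdaMin hPc) (c * lambdaMin hP₀))
    (sq_nonneg (euclNorm (stackedEps r s t)))
  linarith

lemma continuousOn_lyapV (Pc P₀ : Matrix (Fin N × Fin n) (Fin N × Fin n) ℝ) (c : ℝ)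
    {r : ℝ → ℝ} {s : Signals N n} {A : Set ℝ}
    (h : ∀ k, ContinuousOn (etaHat r s k) A ∧ ContinuousOn (epsErr r s k) A) :
    ContinuousOn (lyapV Pc P₀ c r s) A := by
  have h1 : ∀ p : Fin N × Fin n, ContinuousOn (fun t => etaHat r s p.1 t p.2) A :=
    fun p => continuousOn_pi.1 (h p.1).1 p.2
  have h2 : ∀ p : Fin N × Fin n, ContinuousOn (fun t => epsErr r s p.1 t p.2) A :=
    fun p => continuousOn_pi.1 (h p.1).2 p.2
  unfold lyapV
  simp only [dotProduct, mulVec]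
  fun_prop

/-! ### Dissipation along the closed loop -/

lemma hasDerivAt_lyapV_le [NeZero n] {Gr : SimpleGraph (Fin N)} [DecidableRel Gr.Adj]
    {pin : Finset (Fin N)} {K G : Fin n → ℝ} {c₁ : ℝ} (hc₁ : 0 < c₁ ∧ c₁ < 1)
    {Pc P₀ : Matrix (Fin N × Fin n) (Fin N × Fin n) ℝ} (hPc : Pc.IsHermitian)
    (hP₀ : P₀.IsHermitian)
    (hPcA : (-(c₁ • (Pc * closedA Gr pin K + (closedA Gr pin K)ᵀ * Pc))
      - (2 : ℝ) • 1).PosSemidef)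
    (hP₀A : (-(P₀ * observerA N G + (observerA N G)ᵀ * P₀) - 1).PosSemidef)
    {ϱ : Fin N → Fin n → ℝ} {Δ : Fin N → ℝ} (hΔ : ∀ k, Δ k < 1)
    (hΔmax : ∀ k, Δ k ≤ 1 / frobNorm (Pc * gainA N G)) {c : ℝ}
    (hc : c = 4 * frobNorm (Pc * gainA N G) ^ 2 / (c₁⁻¹ - 1) + 1)
    {F₀ : ℝ → (Fin n → ℝ) → Fin n → ℝ} {F : Fin N → ℝ → (Fin n → ℝ) → Fin n → ℝ}
    {θ : Fin N → ℝ → ℝ} {s : Signals N n} (hF : GrowthBound ϱ F₀ F s.x₀)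
    (hθ : SensitivityBound Δ θ) {r : ℝ → ℝ} {t : ℝ} (ht : 0 ≤ t) (hr : 1 ≤ r t)
    (hq : 0 ≤ deriv r t / r t)
    (hd : ∀ k, HasDerivAt (etaHat r s k)
      (r t • (chainA n *ᵥ etaHat r s k t + control Gr pin K r s k t • inputB n
          + (θ k t * epsErr r s k t 0) • G + ((θ k t - 1) * etaHat r s k t 0) • G)
        + (deriv r t / r t) • (weightD n *ᵥ etaHat r s k t)) t ∧
    HasDerivAt (epsErr r s k)
      (r t • ((chainA n - Matrix.vecMulVec G (outputC n)) *ᵥ epsErr r s k t + phi F₀ F r s k t)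
        + (deriv r t / r t) • (weightD n *ᵥ epsErr r s k t)) t) :
    ∃ v', HasDerivAt (lyapV Pc P₀ c r s) v' t ∧
      v' ≤ -(r t * min (c₁⁻¹ - 1) 1
        - deriv r t / r t * (2 * frobNorm (Pc * stackedWeight N n)
          + 2 * c * frobNorm (P₀ * stackedWeight N n))
        - 4 * c * frobNorm P₀ * growthConst ϱ) * stateNorm r s t ^ 2 := by
  set H := stackedEta r s t with hH
  set Z := stackedEps r s t with hZ
  set q := deriv r t / r t with hqdef
  let X : Fin N × Fin n → ℝ := fun p => θ p.1 t * Z p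
  let Y : Fin N × Fin n → ℝ := fun p => (θ p.1 t - 1) * H p
  let Ψ : Fin N × Fin n → ℝ := fun p => r t * phi F₀ F r s p.1 t p.2
  have hη : HasDerivAt (stackedEta r s)
      (r t • (closedA Gr pin K *ᵥ H + gainA N G *ᵥ X + gainA N G *ᵥ Y)
        + q • (stackedWeight N n *ᵥ H)) t := by
    refine hasDerivAt_pi.2 fun p => ?_
    refine (hasDerivAt_pi.1 (hd p.1).1 p.2).congr_deriv ?_
    simp only [Pi.add_apply, Pi.smul_apply, smul_eq_mul, hH, closedA_mulVec_stackedEta,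
      gainA_mulVec_apply, stackedWeight_mulVec_apply]
    rfl
  have hε : HasDerivAt (stackedEps r s)
      (r t • (observerA N G *ᵥ Z) + Ψ + q • (stackedWeight N n *ᵥ Z)) t := by
    refine hasDerivAt_pi.2 fun p => ?_
    refine (hasDerivAt_pi.1 (hd p.1).2 p.2).congr_deriv ?_
    simp only [Pi.add_apply, Pi.smul_apply, smul_eq_mul, observerA, one_kronecker_mulVec_apply,
      stackedWeight_mulVec_apply, mul_add]
    rfl
  refine ⟨_, (hasDerivAt_quadForm hPc hη).add ((hasDerivAt_quadForm hP₀ hε).const_mul c), ?_⟩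
  rw [stateNorm_sq]
  -- Here `|θ| ≤ 1 + Δ < 2`.
  have hX : euclNorm X ≤ 2 * euclNorm Z := by
    refine euclNorm_le_of_abs_le zero_le_two fun p => ?_
    rw [abs_mul]
    refine mul_le_mul_of_nonneg_right ?_ (abs_nonneg _)
    have h1 := (hθ p.1).2 t ht
    have h2 := hΔ p.1
    rw [abs_le]
    constructor <;> linarith [h1.1, h1.2]
  have hp0 := frobNorm_nonneg (Pc * gainA N G)
  have hY : frobNorm (Pc * gainA N G) * euclNorm Y ≤ euclNorm H := by
    have : euclNorm Y ≤ 1 / frobNorm (Pc * gainA N G) * euclNorm H := by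
      refine euclNorm_le_of_abs_le (by positivity) fun p => ?_
      rw [abs_mul]
      refine mul_le_mul_of_nonneg_right ?_ (abs_nonneg _)
      have h1 := (hθ p.1).2 t ht
      have h2 := hΔmax p.1
      rw [abs_le]
      constructor <;> linarith [h1.1, h1.2]
    refine (mul_le_mul_of_nonneg_left this hp0).trans ?_
    rw [← mul_assoc]
    refine mul_le_of_le_one_left (euclNorm_nonneg H) ?_
    rw [mul_one_div]
    -- This also covers `P_c A_g = 0`, where the quotient is `0` by convention.
    exact div_self_le_one _
  exact dissipation_stacked hPc hP₀ hc₁ hPcA hP₀A hc (growthConst_nonneg ϱ) (by linarith) hq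
    hX hY (euclNorm_gain_mul_phi_le hF ht hr)

/-- For every rate `γ` the gain can be chosen so large that `V' ≤ -γ α₀ V` along the closed loop. -/
lemma exists_gain_dissipation [NeZero n] {Gr : SimpleGraph (Fin N)} [DecidableRel Gr.Adj]
    {pin : Finset (Fin N)} {K G : Fin n → ℝ} {c₁ : ℝ} (hc₁ : 0 < c₁ ∧ c₁ < 1)
    {Pc P₀ : Matrix (Fin N × Fin n) (Fin N × Fin n) ℝ} (hPc : Pc.IsHermitian)
    (hP₀ : P₀.IsHermitian)
    (hPcA : (-(c₁ • (Pc * closedA Gr pin K + (closedA Gr pin K)ᵀ * Pc))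
      - (2 : ℝ) • 1).PosSemidef)
    (hP₀A : (-(P₀ * observerA N G + (observerA N G)ᵀ * P₀) - 1).PosSemidef)
    (ϱ : Fin N → Fin n → ℝ) {Δ : Fin N → ℝ} (hΔ : ∀ k, Δ k < 1)
    (hΔmax : ∀ k, Δ k ≤ 1 / frobNorm (Pc * gainA N G)) {tf δ : ℝ} (htf : 0 < tf) (hδ : 0 < δ) :
    ∃ c : ℝ, 0 < c ∧ ∀ γ : ℝ, 0 < γ → ∃ b : ℝ, tf + δ ≤ b ∧
      ∀ (F₀ : ℝ → (Fin n → ℝ) → Fin n → ℝ) (F : Fin N → ℝ → (Fin n → ℝ) → Fin n → ℝ)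
        (θ : Fin N → ℝ → ℝ) (s : Signals N n) (t₀ : ℝ) (S : EReal),
        GrowthBound ϱ F₀ F s.x₀ → SensitivityBound Δ θ → 0 ≤ t₀ →
        IsClosedLoop Gr pin K G F₀ F θ (gain b tf δ) t₀ S s →
        ∃ E : Set ℝ, IsLocallyFinite E ∧ ∀ t, t₀ < t → (t : EReal) < S → t ∉ E → t ≠ tf ∧
          ∃ v', HasDerivAt (lyapV Pc P₀ c (gain b tf δ) s) v' t ∧
            v' ≤ -(γ * alphaSat tf δ t) * lyapV Pc P₀ c (gain b tf δ) s t := by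
  have hμ : 0 < c₁⁻¹ - 1 := sub_pos.2 ((one_lt_inv₀ hc₁.1).2 hc₁.2)
  obtain ⟨c, hc⟩ : ∃ c, c = 4 * frobNorm (Pc * gainA N G) ^ 2 / (c₁⁻¹ - 1) + 1 := ⟨_, rfl⟩
  have hc0 : 0 < c := by rw [hc]; positivity
  refine ⟨c, hc0, fun γ hγ => ?_⟩
  set m := min (c₁⁻¹ - 1) 1 with hm
  have hm0 : 0 < m := lt_min hμ one_pos
  set C₂ := 2 * frobNorm (Pc * stackedWeight N n) + 2 * c * frobNorm (P₀ * stackedWeight N n)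
    with hC₂
  set C₁ := 4 * c * frobNorm P₀ * growthConst ϱ with hC₁
  set C₃ := frobNorm Pc + c * frobNorm P₀ with hC₃
  have hC₂0 : 0 ≤ C₂ := by
    have := frobNorm_nonneg (Pc * stackedWeight N n)
    have := frobNorm_nonneg (P₀ * stackedWeight N n)
    positivity
  have hC₁0 : 0 ≤ C₁ := by
    have := frobNorm_nonneg P₀
    have := growthConst_nonneg ϱ
    positivity
  -- The first entry ensures `r ≥ 1`. The second ensures that `b m` pays for the weights `C₂`, the
  -- nonlinearity `C₁` (at the price `t_f + δ` of expressing it as a multiple of `α₀`) and the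
  -- required decay `γ V`, where `V ≤ C₃ |(η̂, ε)|²`.
  refine ⟨max (tf + δ) ((C₂ + C₁ * (tf + δ) + γ * C₃) / m), le_max_left _ _, ?_⟩
  set b := max (tf + δ) ((C₂ + C₁ * (tf + δ) + γ * C₃) / m) with hb
  have hbT : tf + δ ≤ b := le_max_left _ _
  have hbm : C₂ + C₁ * (tf + δ) + γ * C₃ ≤ b * m := (div_le_iff₀ hm0).1 (le_max_right _ _)
  rintro F₀ F θ s t₀ S hF hθ ht₀ ⟨-, E, hE, hd⟩
  -- The corner `t_f` of the gain joins the exceptional times.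
  refine ⟨insert tf E, fun x y => ?_, fun t h1 h2 h3 => ?_⟩
  · refine ((hE x y).insert tf).subset ?_
    rintro z ⟨rfl | hz, hz'⟩
    · exact Or.inl rfl
    · exact Or.inr ⟨hz, hz'⟩
  have htne : t ≠ tf := fun h => h3 (Or.inl h)
  have ht : 0 ≤ t := ht₀.trans h1.le
  have hq := deriv_gain_div_mem hδ (lt_of_lt_of_le (by linarith) hbT) htne
  obtain ⟨v', hv, hle⟩ := hasDerivAt_lyapV_le hc₁ hPc hP₀ hPcA hP₀A hΔ hΔmax hc hF hθ ht
    (one_le_gain htf hδ hbT ht) hq.1 (hd t h1 h2 fun h => h3 (Or.inr h))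
  refine ⟨htne, v', hv, hle.trans ?_⟩
  have hV := lyapV_le Pc P₀ hc0.le (gain b tf δ) s t
  have hα := alphaSat_pos (tf := tf) hδ t
  have hαT : 1 ≤ alphaSat tf δ t * (tf + δ) :=
    (div_le_iff₀ (by linarith)).1 (one_div_le_alphaSat htf hδ ht)
  have hcoef : γ * alphaSat tf δ t * C₃ ≤ gain b tf δ t * m
      - deriv (gain b tf δ) t / gain b tf δ t * C₂ - C₁ := by
    have k1 := mul_le_mul_of_nonneg_left hbm hα.le
    have k2 := mul_le_mul_of_nonneg_right hq.2 hC₂0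
    have k3 := mul_le_mul_of_nonneg_left hαT hC₁0
    have k4 : gain b tf δ t = b * alphaSat tf δ t := rfl
    rw [k4] at k2 ⊢
    linarith
  have j1 := mul_le_mul_of_nonneg_right hcoef (sq_nonneg (stateNorm (gain b tf δ) s t))
  have j2 := mul_le_mul_of_nonneg_left hV (mul_pos hγ hα).le
  linarith

end ClosedLoop

/-! ### Decay -/

section Decay

variable {V : ℝ → ℝ} {E : Set ℝ} {γ tf δ t₀ : ℝ} {S : EReal}

lemma Icc_subset_of_lt {a b : ℝ} (ha : t₀ ≤ a) (hb : (b : EReal) < S) :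
    Icc a b ⊆ {t | t₀ ≤ t ∧ (t : EReal) < S} := fun _ hu =>
  ⟨ha.trans hu.1, (EReal.coe_le_coe_iff.2 hu.2).trans_lt hb⟩

/-- Since `V ≥ 0`, the rate `γ α₀` may be lowered to the constant `γ/(t_f + δ)`; the estimate is
then uniform in the initial time. -/
lemma le_mul_exp_of_dissipation (htf : 0 < tf) (hδ : 0 < δ) (hγ : 0 < γ) (ht₀ : 0 ≤ t₀)
    (hV : ∀ t, 0 ≤ V t) (hc : ContinuousOn V {t | t₀ ≤ t ∧ (t : EReal) < S})
    (hE : IsLocallyFinite E)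
    (hd : ∀ t, t₀ < t → (t : EReal) < S → t ∉ E →
      ∃ v', HasDerivAt V v' t ∧ v' ≤ -(γ * alphaSat tf δ t) * V t)
    {a b : ℝ} (ha : t₀ ≤ a) (hab : a ≤ b) (hb : (b : EReal) < S) :
    V b ≤ V a * Real.exp (-(γ / (tf + δ) * (b - a))) := by
  have h := le_mul_exp_of_hasDerivAt_le (v := V) (w := fun t => γ / (tf + δ) * t) (hE a b) hab
    (hc.mono (Icc_subset_of_lt ha hb)) (by fun_prop) fun t ht htE => by
      have hts := Icc_subset_of_lt ha hb (Ioo_subset_Icc_self ht)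
      obtain ⟨v', h1, h2⟩ := hd t (ha.trans_lt ht.1) hts.2
        fun h => htE ⟨h, Ioo_subset_Icc_self ht⟩
      refine ⟨v', γ / (tf + δ), h1, by simpa using (hasDerivAt_id t).const_mul (γ / (tf + δ)),
        h2.trans (mul_le_mul_of_nonneg_right (neg_le_neg ?_) (hV t))⟩
      have := mul_le_mul_of_nonneg_left (one_div_le_alphaSat htf hδ (ht₀.trans hts.1)) hγ.le
      rwa [mul_one_div] at this
  convert h using 3
  ring

/-- Up to `t_f` the rate is integrated exactly: `-γ log(t_f + δ - t)` is a primitive of `γ α₀`. -/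
lemma le_mul_rpow_of_dissipation (htf : 0 < tf) (hδ : 0 < δ)
    (hc : ContinuousOn V {t | 0 ≤ t ∧ (t : EReal) < S}) (hE : IsLocallyFinite E)
    (hd : ∀ t : ℝ, 0 < t → (t : EReal) < S → t ∉ E →
      ∃ v', HasDerivAt V v' t ∧ v' ≤ -(γ * alphaSat tf δ t) * V t)
    (hS : (tf : EReal) < S) :
    V tf ≤ V 0 * (δ / (tf + δ)) ^ γ := by
  have hpos : ∀ t, t ≤ tf → tf + δ - t ≠ 0 := fun t ht => by linarith
  have h := le_mul_exp_of_hasDerivAt_le (v := V) (w := fun t => -(γ * Real.log (tf + δ - t)))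
    (hE 0 tf) htf.le (hc.mono (Icc_subset_of_lt le_rfl hS))
    ((ContinuousOn.log (by fun_prop) fun t ht => hpos t ht.2).const_mul γ |>.neg)
    fun t ht htE => by
      obtain ⟨v', h1, h2⟩ := hd t ht.1 (Icc_subset_of_lt le_rfl hS (Ioo_subset_Icc_self ht)).2
        fun h => htE ⟨h, Ioo_subset_Icc_self ht⟩
      refine ⟨v', γ * alphaSat tf δ t, h1, ?_, h2⟩
      refine ((((hasDerivAt_id t).const_sub (tf + δ)).log
        (hpos t ht.2.le)).const_mul γ).neg.congr_deriv ?_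
      rw [alphaSat, if_pos ht.2]
      simp only [id]
      ring
  have hT : 0 < tf + δ := by linarith
  rw [Real.rpow_def_of_pos (div_pos hδ hT), Real.log_div hδ.ne' hT.ne']
  convert h using 3
  simp only [sub_zero, add_sub_cancel_left]
  ring

end Decay

/-! ### From the Lyapunov function to the tracking errors -/

section Tracking

variable {N n : ℕ}

/-- Every diagonal entry of `Λ_r` is a power of `r` with exponent at least one, hence at least `r`.
The factor `2` comes from the crude bound `(a + b)² ≤ 4(a² + b²)`. -/
lemma norm_trackingError_le {r : ℝ → ℝ} (s : Signals N n) (k : Fin N) {t : ℝ} (hr : 1 ≤ r t) :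
    ‖trackingError s k t‖ ≤ 2 * stateNorm r s t / r t := by
  have hr0 : 0 < r t := by linarith
  have hS : 0 ≤ stateNorm r s t := Real.sqrt_nonneg _
  rw [le_div_iff₀ hr0]
  apply le_of_sq_le_sq _ (by positivity)
  rw [mul_pow, EuclideanSpace.real_norm_sq_eq, Finset.sum_mul]
  have h1 : ∀ i : Fin n, trackingError s k t i ^ 2 * r t ^ 2
      ≤ 4 * (etaHat r s k t i ^ 2 + epsErr r s k t i ^ 2) := by
    intro i
    have h2 : r t ^ 2 ≤ (r t ^ (n - (i : ℕ))) ^ 2 := by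
      have : r t ^ 1 ≤ r t ^ (n - (i : ℕ)) := pow_le_pow_right₀ hr (by have := i.isLt; omega)
      rw [pow_one] at this
      exact pow_le_pow_left₀ hr0.le this 2
    have h3 : trackingError s k t i = s.x k t i - s.x₀ t i := rfl
    have h4 := etaHat_add_epsErr r s k t i
    calc trackingError s k t i ^ 2 * r t ^ 2
        ≤ trackingError s k t i ^ 2 * (r t ^ (n - (i : ℕ))) ^ 2 :=
          mul_le_mul_of_nonneg_left h2 (sq_nonneg _)
      _ = (etaHat r s k t i + epsErr r s k t i) ^ 2 := by rw [h4, h3]; ring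
      _ ≤ _ := by nlinarith [sq_nonneg (etaHat r s k t i - epsErr r s k t i),
            sq_nonneg (etaHat r s k t i), sq_nonneg (epsErr r s k t i)]
  refine (Finset.sum_le_sum fun i _ => h1 i).trans ?_
  rw [mul_pow, stateNorm, Real.sq_sqrt (Finset.sum_nonneg fun _ _ =>
    Finset.sum_nonneg fun _ _ => by positivity), ← Finset.mul_sum]
  have := Finset.single_le_sum (f := fun k => ∑ i, (etaHat r s k t i ^ 2 + epsErr r s k t i ^ 2))
    (fun _ _ => Finset.sum_nonneg fun _ _ => by positivity) (Finset.mem_univ k)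
  linarith

/-- Continuity is postulated for `η̂` and `ε` only; it passes to `e_k` by inverting `Λ_r`. -/
lemma continuousOn_trackingError {r : ℝ → ℝ} {s : Signals N n} {A : Set ℝ} (k : Fin N)
    (hr : Continuous r) (hr0 : ∀ t ∈ A, r t ≠ 0)
    (h1 : ContinuousOn (etaHat r s k) A) (h2 : ContinuousOn (epsErr r s k) A) :
    ContinuousOn (trackingError s k) A := by
  refine (PiLp.continuous_toLp 2 _).comp_continuousOn (continuousOn_pi.2 fun i => ?_)
  have h : ContinuousOn
      (fun t => (etaHat r s k t i + epsErr r s k t i) / r t ^ (n - (i : ℕ))) A :=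
    ((continuousOn_pi.1 h1 i).add (continuousOn_pi.1 h2 i)).div (hr.pow _).continuousOn
      fun t ht => pow_ne_zero _ (hr0 t ht)
  refine h.congr fun t ht => ?_
  dsimp only
  rw [etaHat_add_epsErr, mul_div_cancel_left₀ _ (pow_ne_zero _ (hr0 t ht)), Pi.sub_apply]

lemma stateNorm_le_of_lyapV_le {Pc P₀ : Matrix (Fin N × Fin n) (Fin N × Fin n) ℝ}
    (hPc : Pc.IsHermitian) (hP₀ : P₀.IsHermitian) {c : ℝ} (hc : 0 ≤ c)
    (hl : 0 < min (lambdaMin hPc) (c * lambdaMin hP₀))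
    {r : ℝ → ℝ} {s : Signals N n} {t v : ℝ} (hv : lyapV Pc P₀ c r s t ≤ v) :
    stateNorm r s t ≤ Real.sqrt v / Real.sqrt (min (lambdaMin hPc) (c * lambdaMin hP₀)) := by
  rw [← Real.sqrt_div' _ hl.le]
  refine Real.le_sqrt_of_sq_le ?_
  rw [le_div_iff₀ hl, mul_comm]
  exact (min_lambdaMin_mul_le_lyapV hPc hP₀ hc r s t).trans hv

end Tracking

end PrescribedTime

/-! ### The stability and tracking theorem -/

theorem theorem3 {N n : ℕ} [NeZero n]
    (Gr : SimpleGraph (Fin N)) [DecidableRel Gr.Adj] (hGr : Gr.Connected)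
    (pin : Finset (Fin N)) (hpin : pin.Nonempty)
    (K G : Fin n → ℝ)
    (hK : PrescribedTime.IsHurwitz (PrescribedTime.closedA Gr pin K))
    (hG : PrescribedTime.IsHurwitz (PrescribedTime.observerA N G))
    (c₁ : ℝ) (hc₁ : 0 < c₁ ∧ c₁ < 1)
    (Pc P₀ : Matrix (Fin N × Fin n) (Fin N × Fin n) ℝ) (hPc : Pc.PosDef) (hP₀ : P₀.PosDef)
    (hPcA : (-(c₁ • (Pc * PrescribedTime.closedA Gr pin K
        + (PrescribedTime.closedA Gr pin K)ᵀ * Pc)) - (2 : ℝ) • 1).PosSemidef)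
    (hP₀A : (-(P₀ * PrescribedTime.observerA N G
        + (PrescribedTime.observerA N G)ᵀ * P₀) - 1).PosSemidef)
    (ϱ : Fin N → Fin n → ℝ)
    (Δ : Fin N → ℝ) (hΔ : ∀ k, 0 < Δ k ∧ Δ k < 1)
    (hΔmax : ∀ k, Δ k ≤ 1 / PrescribedTime.frobNorm (Pc * PrescribedTime.gainA N G))
    (tf δ : ℝ) (htf : 0 < tf) (hδ : 0 < δ) :
    ∃ c : ℝ, 0 < c ∧ ∀ γ : ℝ, 0 < γ → ∃ b : ℝ, tf + δ ≤ b ∧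
      (∃ β : ℝ → ℝ → ℝ, PrescribedTime.IsClassKL β ∧
        ∀ (F₀ : ℝ → (Fin n → ℝ) → Fin n → ℝ) (F : Fin N → ℝ → (Fin n → ℝ) → Fin n → ℝ)
          (θ : Fin N → ℝ → ℝ) (s : PrescribedTime.Signals N n) (t₀ : ℝ) (S : EReal),
          PrescribedTime.IsLeaderTrajectory F₀ s.x₀ →
          PrescribedTime.GrowthBound ϱ F₀ F s.x₀ →
          PrescribedTime.SensitivityBound Δ θ → 0 ≤ t₀ →
          PrescribedTime.IsClosedLoop Gr pin K G F₀ F θ (PrescribedTime.gain b tf δ) t₀ S s →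
          ∀ t, t₀ ≤ t → (t : EReal) < S →
            PrescribedTime.stateNorm (PrescribedTime.gain b tf δ) s t
              ≤ β (PrescribedTime.stateNorm (PrescribedTime.gain b tf δ) s t₀) (t - t₀)) ∧
      (∀ (F₀ : ℝ → (Fin n → ℝ) → Fin n → ℝ) (F : Fin N → ℝ → (Fin n → ℝ) → Fin n → ℝ)
          (θ : Fin N → ℝ → ℝ) (s : PrescribedTime.Signals N n) (S : EReal),
          PrescribedTime.IsLeaderTrajectory F₀ s.x₀ →
          PrescribedTime.GrowthBound ϱ F₀ F s.x₀ →
          PrescribedTime.SensitivityBound Δ θ → (tf : EReal) < S →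
          PrescribedTime.IsClosedLoop Gr pin K G F₀ F θ (PrescribedTime.gain b tf δ) 0 S s →
          ∀ k,
            Tendsto (fun t => Metric.infDist (PrescribedTime.trackingError s k t)
              (Metric.closedBall 0 (PrescribedTime.radius b c tf δ γ
                (PrescribedTime.lambdaMin hPc.isHermitian)
                (PrescribedTime.lambdaMin hP₀.isHermitian)
                (PrescribedTime.lyapV Pc P₀ c (PrescribedTime.gain b tf δ) s 0))))
              (𝓝[<] tf) (𝓝 0) ∧
            ∀ t, tf ≤ t → (t : EReal) < S →
              PrescribedTime.trackingError s k t ∈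
                Metric.closedBall 0 (PrescribedTime.radius b c tf δ γ
                  (PrescribedTime.lambdaMin hPc.isHermitian)
                  (PrescribedTime.lambdaMin hP₀.isHermitian)
                  (PrescribedTime.lyapV Pc P₀ c (PrescribedTime.gain b tf δ) s 0))) := by
  have : Nonempty (Fin N) := hGr.nonempty
  have hT : 0 < tf + δ := by linarith
  obtain ⟨c, hc, H⟩ := PrescribedTime.exists_gain_dissipation hc₁ hPc.isHermitian hP₀.isHermitian
    hPcA hP₀A ϱ (fun k => (hΔ k).2) hΔmax htf hδ
  refine ⟨c, hc, fun γ hγ => ?_⟩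
  obtain ⟨b, hb, H⟩ := H γ hγ
  have hb0 : 0 < b := hT.trans_le hb
  set lm := min (PrescribedTime.lambdaMin hPc.isHermitian)
    (c * PrescribedTime.lambdaMin hP₀.isHermitian) with hlm
  have hl : 0 < lm := lt_min (PrescribedTime.lambdaMin_pos hPc)
    (mul_pos hc (PrescribedTime.lambdaMin_pos hP₀))
  have hV0 : ∀ (s : PrescribedTime.Signals N n) t,
      0 ≤ PrescribedTime.lyapV Pc P₀ c (PrescribedTime.gain b tf δ) s t := fun s t =>
    (mul_nonneg hl.le (sq_nonneg _)).trans
      (PrescribedTime.min_lambdaMin_mul_le_lyapV hPc.isHermitian hP₀.isHermitian hc.le _ s t)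
  refine ⟨b, hb, ?_, ?_⟩
  · set C := PrescribedTime.frobNorm Pc + c * PrescribedTime.frobNorm P₀ with hC
    have hC0 : 0 ≤ C := by
      have := PrescribedTime.frobNorm_nonneg Pc
      have := PrescribedTime.frobNorm_nonneg P₀
      positivity
    -- The rate of `V` is halved because the state norm is compared with `√V`. Using `C + 1` instead
    -- of `C` makes positivity of the factor immediate.
    refine ⟨_, PrescribedTime.isClassKL_mul_exp (M := Real.sqrt (C + 1) / Real.sqrt lm)
      (κ := γ / (tf + δ) / 2) (by positivity) (by positivity), ?_⟩
    intro F₀ F θ s t₀ S _ hF hθ ht₀ hcl t ht htS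
    obtain ⟨E, hE, hd⟩ := H F₀ F θ s t₀ S hF hθ ht₀ hcl
    have hdec := PrescribedTime.le_mul_exp_of_dissipation htf hδ hγ ht₀ (hV0 s)
      (PrescribedTime.continuousOn_lyapV Pc P₀ c hcl.1) hE
      (fun u h1 h2 h3 => (hd u h1 h2 h3).2) le_rfl ht htS
    set ρ := PrescribedTime.stateNorm (PrescribedTime.gain b tf δ) s t₀ with hρ
    have hρ0 : 0 ≤ ρ := Real.sqrt_nonneg _
    have hup : PrescribedTime.lyapV Pc P₀ c (PrescribedTime.gain b tf δ) s t₀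
        ≤ (C + 1) * ρ ^ 2 :=
      (PrescribedTime.lyapV_le Pc P₀ hc.le _ s t₀).trans
        (mul_le_mul_of_nonneg_right (by linarith) (sq_nonneg _))
    have := PrescribedTime.stateNorm_le_of_lyapV_le hPc.isHermitian hP₀.isHermitian hc.le hl
      (hdec.trans (mul_le_mul_of_nonneg_right hup (Real.exp_pos _).le))
    refine this.trans (le_of_eq ?_)
    rw [Real.sqrt_mul (by positivity), Real.sqrt_mul (by positivity), Real.sqrt_sq hρ0,
      ← Real.exp_half, ← hlm]
    have he : -(γ / (tf + δ) * (t - t₀)) / 2 = -(γ / (tf + δ) / 2 * (t - t₀)) := by ring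
    rw [he]
    ring
  · intro F₀ F θ s S _ hF hθ hS hcl k
    obtain ⟨E, hE, hd⟩ := H F₀ F θ s 0 S hF hθ le_rfl hcl
    have hcont := PrescribedTime.continuousOn_lyapV Pc P₀ c hcl.1
    have hd' := fun u h1 h2 h3 => (hd u h1 h2 h3).2
    have hVtf := PrescribedTime.le_mul_rpow_of_dissipation htf hδ hcont hE hd' hS
    have hmem : ∀ t, tf ≤ t → (t : EReal) < S → PrescribedTime.trackingError s k t ∈
        Metric.closedBall 0 (PrescribedTime.radius b c tf δ γ
          (PrescribedTime.lambdaMin hPc.isHermitian)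
          (PrescribedTime.lambdaMin hP₀.isHermitian)
          (PrescribedTime.lyapV Pc P₀ c (PrescribedTime.gain b tf δ) s 0)) := by
      intro t ht htS
      have hdec := PrescribedTime.le_mul_exp_of_dissipation htf hδ hγ le_rfl (hV0 s) hcont hE
        hd' htf.le ht htS
      -- After `t_f` the gain is constant and `V` does not exceed `V(t_f)`, so the bound at `t_f`
      -- persists.
      have hmono : PrescribedTime.lyapV Pc P₀ c (PrescribedTime.gain b tf δ) s t
          ≤ PrescribedTime.lyapV Pc P₀ c (PrescribedTime.gain b tf δ) s tf := by
        refine hdec.trans (mul_le_of_le_one_right (hV0 s tf) (Real.exp_le_one_iff.2 ?_))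
        have := mul_nonneg (div_pos hγ hT).le (sub_nonneg.2 ht)
        linarith
      have hgain : PrescribedTime.gain b tf δ t = b / δ := by
        rw [PrescribedTime.gain, PrescribedTime.alphaSat, if_neg (not_lt.2 ht), mul_one_div]
      have h1 := PrescribedTime.norm_trackingError_le (r := PrescribedTime.gain b tf δ) s k
        (PrescribedTime.one_le_gain htf hδ hb (htf.le.trans ht))
      have h2 := PrescribedTime.stateNorm_le_of_lyapV_le hPc.isHermitian hP₀.isHermitian hc.le hl
        (hmono.trans hVtf)
      rw [mem_closedBall_zero_iff]
      refine h1.trans ?_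
      rw [hgain, PrescribedTime.radius, ← hlm]
      have hroot : Real.sqrt ((δ / (tf + δ)) ^ γ) = (δ / (tf + δ)) ^ (γ / 2) := by
        rw [Real.sqrt_eq_rpow, ← Real.rpow_mul (div_pos hδ hT).le]
        congr 1
        ring
      rw [Real.sqrt_mul (hV0 s 0), hroot, ← hlm] at h2
      have hbd : 0 < b / δ := div_pos hb0 hδ
      refine (div_le_div_of_nonneg_right (mul_le_mul_of_nonneg_left h2 zero_le_two)
        hbd.le).trans (le_of_eq ?_)
      have := (Real.sqrt_pos.2 hl).ne'
      field_simp
    refine ⟨?_, hmem⟩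
    have hec : ContinuousOn (PrescribedTime.trackingError s k) {t | 0 ≤ t ∧ (t : EReal) < S} :=
      PrescribedTime.continuousOn_trackingError k
        (PrescribedTime.continuous_gain (b := b) (tf := tf) hδ)
        (fun t ht => (zero_lt_one.trans_le
          (PrescribedTime.one_le_gain htf hδ hb ht.1)).ne') (hcl.1 k).1 (hcl.1 k).2
    have hlim : Tendsto (PrescribedTime.trackingError s k) (𝓝[<] tf)
        (𝓝 (PrescribedTime.trackingError s k tf)) := by
      have h1 := (hec.mono (PrescribedTime.Icc_subset_of_lt le_rfl hS)) tf
        (right_mem_Icc.2 htf.le)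
      have h2 : 𝓝[<] tf ≤ 𝓝[Icc 0 tf] tf := by
        rw [← nhdsWithin_Ioo_eq_nhdsLT htf]
        exact nhdsWithin_mono _ Ioo_subset_Icc_self
      exact h1.mono_left h2
    -- Convergence to `Ω` is continuity of `e_k` at `t_f` together with `e_k(t_f) ∈ Ω`.
    have h3 := ((Metric.continuous_infDist_pt (Metric.closedBall 0 (PrescribedTime.radius b c tf δ γ
      (PrescribedTime.lambdaMin hPc.isHermitian) (PrescribedTime.lambdaMin hP₀.isHermitian)
      (PrescribedTime.lyapV Pc P₀ c (PrescribedTime.gain b tf δ) s 0)))).tendsto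
        (PrescribedTime.trackingError s k tf)).comp hlim
    rwa [Metric.infDist_zero_of_mem (hmem tf le_rfl hS)] at h3
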